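/- Let $0<r_1<\dots<r_K$ be known rates. For $\theta\in[0,1]^K$ let $X_k(i)$ ($1\le k\le K$, $i\ge 1$) be independent random variables, $X_k(i)$ being Bernoulli with mean $\theta_k$. In each slot $t=1,2,\dots$ a (possibly randomized) algorithm $\pi$, which does not know $\theta$, selects a decision $k\in\{1,\dots,K\}$ on the basis of its past decisions, the successes and failures they produced, and a private random seed independent of the $X_k(i)$; if $k$ is selected for the $i$-th time, the outcome $X_k(i)$ is observed and the reward $r_kX_k(i)$ is received. Let $t_k^\pi(T)$ be the number of times $k$ is selected in the slots $1,\dots,T$. Call $k^\star$ the optimal decision for $\theta$ if $r_{k^\star}\theta_{k^\star}>r_k\theta_k$ for all $k\ne k^\star$, and define the regret $$R^\pi(T)=\theta_{k^\star}r_{k^\star}T-\sum_{k=1}^K\theta_kr_k\,\mathbb{E}_\theta[t_k^\pi(T)].$$ The algorithm $\pi$ is uniformly good if, for every $\theta\in[0,1]^K$ that has a (unique) optimal decision $k^\star$, every $\alpha>0$ and every $k\neq k^\star$, $\mathbb{E}_\theta[t_k^\pi(T)]=o(T^\alpha)$ as $T\to\infty$. For $p,q\in[0,1]$ let $I(p,q)=p\log\frac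 pq+(1-p)\log\frac{1-p}{1-q}\in[0,\infty]$, with the conventions $0\log\frac0x=0$ for all $x\ge 0$ and $x\log\frac x0=\infty$ for $x>0$. Theorem. Let $\pi$ be uniformly good, and let $\theta\in[0,1]^K$ have the (unique) optimal decision $k^\star$. Put $k_0=\min\{k\in\{1,\dots,k^\star\}: r_{k^\star}\theta_{k^\star}/r_k\le 1\}$. Then $$\liminf_{T\to\infty}\frac{R^\pi(T)}{\log T}\ \ge\ c'(\theta):=\sum_{k=k_0,\ k\neq k^\star}^{K}\frac{r_{k^\star}\theta_{k^\star}-r_k\theta_k}{I\big(\theta_k,\ r_{k^\star}\theta_{k^\star}/r_k\big)},$$ where a term whose denominator is infinite is $0$. -/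

import Mathlib

open MeasureTheory ProbabilityTheory Filter Asymptotics
open scoped Topology unitInterval

namespace RateBandit

noncomputable section

/-- What the decision maker has seen: the decisions already taken together with the success
(`true`) or failure (`false`) observed after each of them, the most recent one first. -/
abbrev History (K : ℕ) : Type := List (Fin K × Bool)

/-- The number of times decision `k` occurs in a history. -/
def timesTaken {K : ℕ} (h : History K) (k : Fin K) : ℕ := (h.map Prod.fst).count k

/-- A sequential rate selection algorithm for `K` rates: the next decision is a function of the
observed history and of a private random seed with values in `S`. Taking a one-point `S` gives
the deterministic algorithms. -/
structure Algorithm (K : ℕ) (S : Type*) [MeasurableSpace S] where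
  select : S → History K → Fin K
  measurable_select : ∀ h : History K, Measurable fun s => select s h

/-- The table of all the variables `X_k(i)`: the entry at `(k, i)` tells whether the `(i+1)`-th
use of decision `k` is a success. -/
abbrev Table (K : ℕ) : Type := Fin K × ℕ → Bool

/-- The law of the table for independent arms: all entries are independent, and those of arm `k`
are Bernoulli with mean `θ k`. -/
def tableLaw {K : ℕ} (θ : Fin K → I) : Measure (Table K) :=
  Measure.infinitePi fun p : Fin K × ℕ => bernoulliMeasure true false (θ p.1)

/-- The joint law of the seed of the algorithm and of the table, which are independent. -/
def law {K : ℕ} {S : Type*} [MeasurableSpace S] (ν : Measure S) (θ : Fin K → I) :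
    Measure (S × Table K) :=
  ν.prod (tableLaw θ)

/-- The history after the first `T` slots: in each slot the algorithm selects a decision `k`, and
if `k` was selected `i` times before, the outcome is the entry of the table at `(k, i)`. -/
def Algorithm.history {K : ℕ} {S : Type*} [MeasurableSpace S] (π : Algorithm K S)
    (ω : S × Table K) : ℕ → History K
  | 0 => []
  | T + 1 =>
    let h := π.history ω T
    let k := π.select ω.1 h
    (k, ω.2 (k, timesTaken h k)) :: h

/-- `t_k(T)`, the number of times decision `k` has been taken in the first `T` slots. -/
def Algorithm.pulls {K : ℕ} {S : Type*} [MeasurableSpace S] (π : Algorithm K S)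
    (k : Fin K) (T : ℕ) (ω : S × Table K) : ℕ :=
  timesTaken (π.history ω T) k

/-- `𝔼[t_k(T)]` under the parameter `θ`. -/
def Algorithm.expectedPulls {K : ℕ} {S : Type*} [MeasurableSpace S] (π : Algorithm K S)
    (ν : Measure S) (θ : Fin K → I) (k : Fin K) (T : ℕ) : ℝ :=
  ∫ ω, (π.pulls k T ω : ℝ) ∂(law ν θ)

/-- `k` is the unique optimal decision for the rates `r` and the parameter `θ`. -/
def IsOptimal {K : ℕ} (r : Fin K → ℝ) (θ : Fin K → I) (k : Fin K) : Prop :=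
  ∀ l, l ≠ k → r l * θ l < r k * θ k

/-- Uniformly good algorithms: for every parameter in `[0,1]^K` with a unique optimal decision, a
suboptimal decision is taken `o(T^α)` times in expectation, for every `α > 0`. -/
def Algorithm.UniformlyGood {K : ℕ} {S : Type*} [MeasurableSpace S] (π : Algorithm K S)
    (ν : Measure S) (r : Fin K → ℝ) : Prop :=
  ∀ (θ : Fin K → I) (kstar : Fin K), IsOptimal r θ kstar →
    ∀ α : ℝ, 0 < α → ∀ k, k ≠ kstar →
      (fun T : ℕ => π.expectedPulls ν θ k T) =o[atTop] fun T : ℕ => (T : ℝ) ^ α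

/-- The regret `R(T) = θ_{k*} r_{k*} T - ∑_k θ_k r_k 𝔼[t_k(T)]`. -/
def Algorithm.regret {K : ℕ} {S : Type*} [MeasurableSpace S] (π : Algorithm K S)
    (ν : Measure S) (r : Fin K → ℝ) (θ : Fin K → I) (kstar : Fin K) (T : ℕ) : ℝ :=
  θ kstar * r kstar * T - ∑ k, θ k * r k * π.expectedPulls ν θ k T

open Classical in
/-- The Kullback-Leibler divergence between the Bernoulli laws of means `p, q ∈ [0,1]`, with the
usual conventions `0 log (0/x) = 0` and `x log (x/0) = ∞` for `x > 0`. -/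
def bernoulliKL (p q : ℝ) : EReal :=
  if (q = 0 ∧ p ≠ 0) ∨ (q = 1 ∧ p ≠ 1) then ⊤
  else ((p * Real.log (p / q) + (1 - p) * Real.log ((1 - p) / (1 - q)) : ℝ) : EReal)

/-- The constant `c'(θ)`, a sum over the decisions `k ≥ k₀`, `k ≠ k*`. A term with an infinite
divergence is zero. -/
def lowerConstant {K : ℕ} (r : Fin K → ℝ) (θ : Fin K → I) (kstar k₀ : Fin K) : EReal :=
  ∑ k ∈ (Finset.Ici k₀).erase kstar,
    ((r kstar * θ kstar - r k * θ k : ℝ) : EReal) /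
      bernoulliKL (θ k) (r kstar * θ kstar / r k)

end

end RateBandit

/-! This is the Lai–Robbins change-of-measure argument, one arm at a time. Fix a suboptimal arm `k`
and raise its mean to some `q < 1` just above the threshold `r kstar * θ kstar / r k`, so that `k`
becomes optimal. A uniformly good algorithm rarely uses `k` under `θ` and nearly always uses it
under the new parameter. Telling the two apart requires information, and only uses of `k` supply it,
each contributing `realKL (θ k) q` in expectation.

A history has probability (measure of its seed event) times (likelihood of its outcomes), by
`Algorithm.history_eq_iff` and `tableLaw_real_tableEvent`. The seed factor is common to both
parameters, so expectations are finite sums and the change of measure compares likelihoods only.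
`Algorithm.sub_le_realKL_mul_expectedPulls` is the resulting non-asymptotic inequality. Taking `c =
γ log T` with `γ < 1`, and then `q` close to the threshold, gives the bound for each arm; the regret
is the gap-weighted sum of expected uses. -/

namespace RateBandit

noncomputable section

/-! ### The law of the history -/

section Law

variable {K : ℕ} {S : Type*} [MeasurableSpace S]

/-- The probability that a Bernoulli variable of mean `p` takes the value `b`. -/
def outcomeProb (p : ℝ) (b : Bool) : ℝ := if b then p else 1 - p

/-- The probability of the outcomes recorded in a history, given the decisions. -/
def likelihood (θ : Fin K → I) : History K → ℝ
  | [] => 1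
  | a :: h => likelihood θ h * outcomeProb (θ a.1) a.2

/-- The seeds with which the algorithm takes the decisions recorded in a history, provided that
the outcomes are the recorded ones. -/
def Algorithm.seedEvent (π : Algorithm K S) : History K → Set S
  | [] => Set.univ
  | a :: h => π.seedEvent h ∩ {s | π.select s h = a.1}

/-- The tables that agree with the outcomes recorded in a history. -/
def tableEvent : History K → Set (Table K)
  | [] => Set.univ
  | a :: h => tableEvent h ∩ {x | x (a.1, timesTaken h a.1) = a.2}

/-- The entries of the table that are recorded in a history. -/
def usedEntries : History K → Finset (Fin K × ℕ)
  | [] => ∅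
  | a :: h => insert (a.1, timesTaken h a.1) (usedEntries h)

/-- A table that agrees with the outcomes recorded in a history. -/
def recordedTable : History K → Table K
  | [] => fun _ => true
  | a :: h => Function.update (recordedTable h) (a.1, timesTaken h a.1) a.2

/-- Extending a history by one slot. -/
def consEmbedding (K : ℕ) : History K × (Fin K × Bool) ↪ History K where
  toFun p := p.2 :: p.1
  inj' p q h := by
    simp only [List.cons.injEq] at h
    exact Prod.ext h.2 h.1

lemma consEmbedding_apply (p : History K × (Fin K × Bool)) : consEmbedding K p = p.2 :: p.1 := rfl

/-- The histories of length `T`. -/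
def histories (K : ℕ) : ℕ → Finset (History K)
  | 0 => {[]}
  | T + 1 => ((histories K T) ×ˢ Finset.univ).map (consEmbedding K)

lemma timesTaken_cons (a : Fin K × Bool) (h : History K) (k : Fin K) :
    timesTaken (a :: h) k = timesTaken h k + if a.1 = k then 1 else 0 := by
  simp [timesTaken, List.count_cons]

lemma mem_histories {T : ℕ} {h : History K} : h ∈ histories K T ↔ h.length = T := by
  induction T generalizing h with
  | zero => simp [histories, List.length_eq_zero_iff]
  | succ T ih =>
    cases h with
    | nil => simp [histories, consEmbedding_apply]
    | cons a h => simp [histories, ih, consEmbedding_apply]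

lemma sum_histories_succ (T : ℕ) (f : History K → ℝ) :
    ∑ h ∈ histories K (T + 1), f h =
      ∑ h ∈ histories K T, ∑ k, ∑ b, f ((k, b) :: h) := by
  simp only [histories, Finset.sum_map, consEmbedding_apply, Finset.sum_product,
    Fintype.sum_prod_type]

/-- Each slot reads a fresh entry of the table. The recorded outcomes therefore constrain distinct
coordinates, and independence gives a product. -/
lemma lt_of_mem_usedEntries {h : History K} {p : Fin K × ℕ} (hp : p ∈ usedEntries h) :
    p.2 < timesTaken h p.1 := by
  induction h with
  | nil => simp [usedEntries] at hp
  | cons a h ih =>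
    rw [timesTaken_cons]
    rcases Finset.mem_insert.1 hp with rfl | hp
    · simp
    · exact (ih hp).trans_le (Nat.le_add_right _ _)

lemma notMem_usedEntries (h : History K) (k : Fin K) : (k, timesTaken h k) ∉ usedEntries h :=
  fun hp => (lt_of_mem_usedEntries hp).false

lemma tableEvent_eq_pi (h : History K) :
    tableEvent h = Set.pi (usedEntries h) fun p => {recordedTable h p} := by
  induction h with
  | nil => simp [tableEvent, usedEntries]
  | cons a h ih =>
    ext x
    simp only [tableEvent, ih, usedEntries, recordedTable, Set.mem_inter_iff, Set.mem_pi,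
      Finset.mem_coe, Set.mem_singleton_iff, Set.mem_ofPred_eq, Finset.mem_insert,
      forall_eq_or_imp, Function.update_self]
    rw [and_comm]
    refine and_congr_right fun _ => forall₂_congr fun p hp => ?_
    rw [Function.update_of_ne]
    rintro rfl
    exact notMem_usedEntries h a.1 hp

lemma measurableSet_tableEvent (h : History K) : MeasurableSet (tableEvent h) := by
  rw [tableEvent_eq_pi]
  exact MeasurableSet.pi (Finset.countable_toSet _) fun _ _ => measurableSet_singleton _

lemma measurableSet_select_eq (π : Algorithm K S) (h : History K) (k : Fin K) :
    MeasurableSet {s | π.select s h = k} :=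
  π.measurable_select h (measurableSet_singleton k)

lemma Algorithm.measurableSet_seedEvent (π : Algorithm K S) (h : History K) :
    MeasurableSet (π.seedEvent h) := by
  induction h with
  | nil => exact MeasurableSet.univ
  | cons a h ih => exact ih.inter (measurableSet_select_eq π h a.1)

lemma bernoulliMeasure_real_singleton (p : I) (b : Bool) :
    (bernoulliMeasure true false p).real {b} = outcomeProb p b := by
  cases b <;> simp [outcomeProb]

lemma tableLaw_real_tableEvent (θ : Fin K → I) (h : History K) :
    (tableLaw θ).real (tableEvent h) = likelihood θ h := by
  have key : ∀ h : History K, (tableLaw θ).real (tableEvent h) =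
      ∏ p ∈ usedEntries h, outcomeProb (θ p.1) (recordedTable h p) := by
    intro h
    rw [tableEvent_eq_pi, measureReal_def, tableLaw,
      Measure.infinitePi_pi _ fun _ _ => measurableSet_singleton _, ENNReal.toReal_prod]
    exact Finset.prod_congr rfl fun p _ => bernoulliMeasure_real_singleton _ _
  rw [key]
  induction h with
  | nil => simp [usedEntries, likelihood]
  | cons a h ih =>
    rw [usedEntries, Finset.prod_insert (notMem_usedEntries h a.1), likelihood, ← ih, mul_comm]
    congr 1
    · refine Finset.prod_congr rfl fun p hp => ?_
      rw [recordedTable, Function.update_of_ne]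
      rintro rfl
      exact notMem_usedEntries h a.1 hp
    · simp [recordedTable]

lemma Algorithm.length_history (π : Algorithm K S) (ω : S × Table K) (T : ℕ) :
    (π.history ω T).length = T := by
  induction T with
  | zero => rfl
  | succ T ih => simp [Algorithm.history, ih]

/-- Once the history is fixed, its decisions constrain only the seed and its outcomes only the
table, so the event is a rectangle. -/
lemma Algorithm.history_eq_iff (π : Algorithm K S) (ω : S × Table K) (h : History K) :
    π.history ω h.length = h ↔ ω.1 ∈ π.seedEvent h ∧ ω.2 ∈ tableEvent h := by
  induction h with
  | nil => simp [Algorithm.history, Algorithm.seedEvent, tableEvent]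
  | cons a h ih =>
    simp only [List.length_cons, Algorithm.history, List.cons.injEq, Algorithm.seedEvent,
      tableEvent, Set.mem_inter_iff, Set.mem_ofPred_eq]
    constructor
    · rintro ⟨ha, hh⟩
      rw [hh] at ha
      obtain ⟨h1, h2⟩ := ih.1 hh
      rw [← ha]
      exact ⟨⟨h1, rfl⟩, h2, rfl⟩
    · rintro ⟨⟨h1, hs⟩, h2, hx⟩
      have hh := ih.2 ⟨h1, h2⟩
      rw [hh, hs]
      exact ⟨Prod.ext rfl hx, rfl⟩

instance (θ : Fin K → I) : IsProbabilityMeasure (tableLaw θ) := by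
  unfold tableLaw; infer_instance

instance (ν : Measure S) [IsProbabilityMeasure ν] (θ : Fin K → I) :
    IsProbabilityMeasure (law ν θ) := by
  unfold law; infer_instance

/-- The expectation of a function of the history of the first `T` slots. -/
def Algorithm.historyMean (π : Algorithm K S) (ν : Measure S) (θ : Fin K → I) (T : ℕ)
    (f : History K → ℝ) : ℝ :=
  ∑ h ∈ histories K T, ν.real (π.seedEvent h) * likelihood θ h * f h

lemma Algorithm.integral_history (π : Algorithm K S) (ν : Measure S) [IsProbabilityMeasure ν]
    (θ : Fin K → I) (T : ℕ) (f : History K → ℝ) :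
    ∫ ω, f (π.history ω T) ∂(law ν θ) = π.historyMean ν θ T f := by
  have hset : ∀ h ∈ histories K T,
      {ω | π.history ω T = h} = π.seedEvent h ×ˢ tableEvent h := by
    intro h hh
    ext ω
    rw [← mem_histories.1 hh]
    exact π.history_eq_iff ω h
  have hmeas : ∀ h ∈ histories K T, MeasurableSet {ω | π.history ω T = h} := fun h hh => by
    rw [hset h hh]
    exact (π.measurableSet_seedEvent h).prod (measurableSet_tableEvent h)
  have hsum : ∀ ω, f (π.history ω T) =
      ∑ h ∈ histories K T, {ω | π.history ω T = h}.indicator (fun _ => f h) ω := by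
    intro ω
    have hmem : π.history ω T ∈ histories K T := mem_histories.2 (π.length_history ω T)
    simp [Set.indicator_apply, hmem]
  simp_rw [hsum]
  rw [integral_finsetSum _ fun h hh => (integrable_const (f h)).indicator (hmeas h hh),
    Algorithm.historyMean]
  refine Finset.sum_congr rfl fun h hh => ?_
  rw [integral_indicator_const _ (hmeas h hh), hset h hh, law, measureReal_prod_prod,
    tableLaw_real_tableEvent, smul_eq_mul]

lemma Algorithm.expectedPulls_eq_historyMean (π : Algorithm K S) (ν : Measure S)
    [IsProbabilityMeasure ν] (θ : Fin K → I) (k : Fin K) (T : ℕ) :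
    π.expectedPulls ν θ k T = π.historyMean ν θ T fun h => (timesTaken h k : ℝ) :=
  π.integral_history ν θ T fun h => (timesTaken h k : ℝ)

end Law

end

end RateBandit

namespace RateBandit

noncomputable section

/-! ### Change of measure -/

section ChangeOfMeasure

variable {K : ℕ} {S : Type*} [MeasurableSpace S]

lemma outcomeProb_nonneg (p : I) (b : Bool) : 0 ≤ outcomeProb p b := by
  unfold outcomeProb
  split_ifs
  exacts [p.2.1, sub_nonneg.2 p.2.2]

lemma outcomeProb_pos {q : ℝ} (hq0 : 0 < q) (hq1 : q < 1) (b : Bool) : 0 < outcomeProb q b := by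
  unfold outcomeProb
  split_ifs
  exacts [hq0, sub_pos.2 hq1]

lemma sum_outcomeProb (p : ℝ) : ∑ b, outcomeProb p b = 1 := by
  simp [outcomeProb]

lemma likelihood_nonneg (θ : Fin K → I) (h : History K) : 0 ≤ likelihood θ h := by
  induction h with
  | nil => exact zero_le_one
  | cons a h ih => exact mul_nonneg ih (outcomeProb_nonneg _ _)

lemma Algorithm.sum_real_seedEvent_cons (π : Algorithm K S) (ν : Measure S)
    [IsProbabilityMeasure ν] (h : History K) (b : Bool) :
    ∑ k, ν.real (π.seedEvent ((k, b) :: h)) = ν.real (π.seedEvent h) := by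
  have hU : π.seedEvent h = ⋃ k, π.seedEvent ((k, b) :: h) := by
    ext s
    simp [Algorithm.seedEvent]
  rw [hU, measureReal_iUnion_fintype]
  · intro k l hkl
    refine Set.disjoint_left.2 fun s hs ht => hkl ?_
    exact hs.2.symm.trans ht.2
  · exact fun k => π.measurableSet_seedEvent _

lemma Algorithm.historyMean_const_mul (π : Algorithm K S) (ν : Measure S) (θ : Fin K → I)
    (T : ℕ) (c : ℝ) (f : History K → ℝ) :
    π.historyMean ν θ T (fun h => c * f h) = c * π.historyMean ν θ T f := by
  simp only [Algorithm.historyMean, Finset.mul_sum]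
  exact Finset.sum_congr rfl fun h _ => by ring

lemma Algorithm.historyMean_add (π : Algorithm K S) (ν : Measure S) (θ : Fin K → I)
    (T : ℕ) (f g : History K → ℝ) :
    π.historyMean ν θ T (fun h => f h + g h) =
      π.historyMean ν θ T f + π.historyMean ν θ T g := by
  simp only [Algorithm.historyMean, mul_add, Finset.sum_add_distrib]

lemma Algorithm.historyMean_mono (π : Algorithm K S) (ν : Measure S) (θ : Fin K → I)
    {T : ℕ} {f g : History K → ℝ} (hfg : ∀ h ∈ histories K T, f h ≤ g h) :
    π.historyMean ν θ T f ≤ π.historyMean ν θ T g :=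
  Finset.sum_le_sum fun h hh => mul_le_mul_of_nonneg_left (hfg h hh)
    (mul_nonneg measureReal_nonneg (likelihood_nonneg θ h))

/-- A function of the history that is a martingale has constant expectation. -/
lemma Algorithm.historyMean_eq_of_forall_sum_eq (π : Algorithm K S) (ν : Measure S)
    [IsProbabilityMeasure ν] (θ : Fin K → I) (f : History K → ℝ)
    (hf : ∀ h k, ∑ b, outcomeProb (θ k) b * f ((k, b) :: h) = f h) (T : ℕ) :
    π.historyMean ν θ T f = f [] := by
  induction T with
  | zero => simp [Algorithm.historyMean, histories, Algorithm.seedEvent, likelihood]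
  | succ T ih =>
    rw [← ih, Algorithm.historyMean, sum_histories_succ, Algorithm.historyMean]
    refine Finset.sum_congr rfl fun h _ => ?_
    -- The seed event ignores the last outcome, so `true` serves for both values of `b`.
    rw [← π.sum_real_seedEvent_cons ν h true, mul_assoc, Finset.sum_mul]
    refine Finset.sum_congr rfl fun k _ => ?_
    rw [← hf h k, Finset.mul_sum, Finset.mul_sum]
    refine Finset.sum_congr rfl fun b _ => ?_
    simp only [likelihood, Algorithm.seedEvent]
    ring

lemma Algorithm.historyMean_const (π : Algorithm K S) (ν : Measure S)
    [IsProbabilityMeasure ν] (θ : Fin K → I) (T : ℕ) (c : ℝ) :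
    π.historyMean ν θ T (fun _ => c) = c :=
  π.historyMean_eq_of_forall_sum_eq ν θ _
    (fun h k => by rw [← Finset.sum_mul, sum_outcomeProb, one_mul]) T

lemma sum_timesTaken (h : History K) : ∑ k, timesTaken h k = h.length := by
  induction h with
  | nil => simp [timesTaken]
  | cons a h ih => simp [timesTaken_cons, Finset.sum_add_distrib, ih]

lemma timesTaken_le_length (h : History K) (k : Fin K) : timesTaken h k ≤ h.length :=
  (Finset.single_le_sum (fun _ _ => Nat.zero_le _) (Finset.mem_univ k)).trans_eq
    (sum_timesTaken h)

lemma Algorithm.expectedPulls_nonneg (π : Algorithm K S) (ν : Measure S) (θ : Fin K → I)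
    (k : Fin K) (T : ℕ) : 0 ≤ π.expectedPulls ν θ k T :=
  integral_nonneg fun _ => Nat.cast_nonneg _

lemma Algorithm.sum_expectedPulls (π : Algorithm K S) (ν : Measure S) [IsProbabilityMeasure ν]
    (θ : Fin K → I) (T : ℕ) : ∑ k, π.expectedPulls ν θ k T = T := by
  simp only [Algorithm.expectedPulls_eq_historyMean]
  rw [← π.historyMean_const ν θ T (T : ℝ)]
  simp only [Algorithm.historyMean]
  rw [Finset.sum_comm]
  refine Finset.sum_congr rfl fun h hh => ?_
  rw [← Finset.mul_sum, ← Nat.cast_sum, sum_timesTaken, mem_histories.1 hh]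

/-- The log-likelihood ratio of a history when the mean of arm `k` is `p` rather than `q`. -/
def logRatio (p q : ℝ) (k : Fin K) : History K → ℝ
  | [] => 0
  | a :: h => logRatio p q k h +
      if a.1 = k then Real.log (outcomeProb p a.2 / outcomeProb q a.2) else 0

/-- The Kullback-Leibler divergence between Bernoulli laws as a real number. -/
def realKL (p q : ℝ) : ℝ := p * Real.log (p / q) + (1 - p) * Real.log ((1 - p) / (1 - q))

/-- Wald's identity: the log-ratio minus `realKL (θ k) q` times the number of uses is a martingale
started at 0. -/
lemma Algorithm.historyMean_logRatio (π : Algorithm K S) (ν : Measure S)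
    [IsProbabilityMeasure ν] (θ : Fin K → I) (q : ℝ) (k : Fin K) (T : ℕ) :
    π.historyMean ν θ T (logRatio (θ k) q k) =
      realKL (θ k) q * π.expectedPulls ν θ k T := by
  have h0 := π.historyMean_eq_of_forall_sum_eq ν θ
    (fun h => logRatio (θ k) q k h + (-realKL (θ k) q) * (timesTaken h k : ℝ))
    (fun h l => by
      by_cases hl : l = k
      · subst hl
        simp [logRatio, timesTaken_cons, outcomeProb, realKL]
        ring
      · simp [logRatio, timesTaken_cons, outcomeProb, hl]
        ring) T
  rw [Algorithm.historyMean_add, Algorithm.historyMean_const_mul,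
    ← Algorithm.expectedPulls_eq_historyMean] at h0
  simp only [logRatio, timesTaken, List.map_nil, List.count_nil, Nat.cast_zero, mul_zero,
    add_zero] at h0
  linarith

/-- Equality holds factor by factor while the outcomes have positive probability under `θ`. If `θ k`
is 0 or 1, an impossible outcome makes the left side vanish, hence only `≤`. -/
lemma likelihood_mul_exp_neg_logRatio_le (θ : Fin K → I) (k : Fin K) (q : I) (hq0 : 0 < (q : ℝ))
    (hq1 : (q : ℝ) < 1) (h : History K) :
    likelihood θ h * Real.exp (-logRatio (θ k) q k h) ≤
      likelihood (Function.update θ k q) h := by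
  induction h with
  | nil => simp [likelihood, logRatio]
  | cons a h ih =>
    have hfac : outcomeProb (θ a.1) a.2 *
        Real.exp (-if a.1 = k then Real.log (outcomeProb (θ k) a.2 / outcomeProb q a.2) else 0) ≤
        outcomeProb (Function.update θ k q a.1) a.2 := by
      by_cases ha : a.1 = k
      · have hq := outcomeProb_pos hq0 hq1 a.2
        rw [if_pos ha, ha, Function.update_self]
        rcases (outcomeProb_nonneg (θ k) a.2).eq_or_lt with hp | hp
        · rw [← hp, zero_mul]
          exact hq.le
        · rw [Real.exp_neg, Real.exp_log (div_pos hp hq), inv_div, mul_div_cancel₀ _ hp.ne']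
      · simp [ha]
    calc likelihood θ (a :: h) * Real.exp (-logRatio (θ k) q k (a :: h))
        = (likelihood θ h * Real.exp (-logRatio (θ k) q k h)) * (outcomeProb (θ a.1) a.2 *
            Real.exp (-if a.1 = k then
              Real.log (outcomeProb (θ k) a.2 / outcomeProb q a.2) else 0)) := by
          rw [likelihood, logRatio, neg_add, Real.exp_add]
          ring
      _ ≤ likelihood (Function.update θ k q) h *
            outcomeProb (Function.update θ k q a.1) a.2 :=
          mul_le_mul ih hfac (mul_nonneg (outcomeProb_nonneg _ _) (Real.exp_pos _).le)
            (likelihood_nonneg _ _)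
      _ = likelihood (Function.update θ k q) (a :: h) := rfl

/-- The information inequality for the number of uses of one arm, when its mean is changed. -/
lemma Algorithm.sub_le_realKL_mul_expectedPulls (π : Algorithm K S) (ν : Measure S)
    [IsProbabilityMeasure ν] (θ : Fin K → I) (k : Fin K) (q : I) (hq0 : 0 < (q : ℝ))
    (hq1 : (q : ℝ) < 1) {T : ℕ} (hT : 0 < T) (c : ℝ) :
    c * (1 - π.expectedPulls ν θ k T / T) -
        Real.exp c * (1 - π.expectedPulls ν (Function.update θ k q) k T / T) ≤
      realKL (θ k) q * π.expectedPulls ν θ k T := by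
  have hT' : (0 : ℝ) < T := Nat.cast_pos.2 hT
  -- The test variable: a fraction of slots, with mean near 1 under `θ` and near 0 under the changed
  -- parameter in the application.
  set Y : History K → ℝ := fun h => 1 + (-(T : ℝ)⁻¹) * (timesTaken h k : ℝ) with hY
  have hY0 : ∀ h ∈ histories K T, 0 ≤ Y h ∧ Y h ≤ 1 := by
    intro h hh
    have h1 : (timesTaken h k : ℝ) ≤ T := by
      exact_mod_cast (timesTaken_le_length h k).trans_eq (mem_histories.1 hh)
    have h2 : (T : ℝ)⁻¹ * (timesTaken h k : ℝ) ≤ 1 := by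
      rw [inv_mul_le_iff₀ hT', mul_one]
      exact h1
    have h3 : 0 ≤ (T : ℝ)⁻¹ * (timesTaken h k : ℝ) := by positivity
    constructor <;> simp only [hY] <;> linarith
  have hmeanY : ∀ θ : Fin K → I,
      π.historyMean ν θ T Y = 1 - π.expectedPulls ν θ k T / T := by
    intro θ
    rw [hY, Algorithm.historyMean_add, Algorithm.historyMean_const_mul,
      Algorithm.historyMean_const, ← Algorithm.expectedPulls_eq_historyMean]
    ring
  have h1 : π.historyMean ν θ T
        (fun h => (c * Y h + (-1) * logRatio (θ k) q k h) + 1) ≤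
      π.historyMean ν θ T (fun h => Real.exp (c * Y h + (-1) * logRatio (θ k) q k h)) :=
    π.historyMean_mono ν θ fun h _ => Real.add_one_le_exp _
  have h2 : π.historyMean ν θ T (fun h => Real.exp (c * Y h + (-1) * logRatio (θ k) q k h)) ≤
      π.historyMean ν (Function.update θ k q) T (fun h => Real.exp (c * Y h)) := by
    refine Finset.sum_le_sum fun h _ => ?_
    have := mul_le_mul_of_nonneg_left (likelihood_mul_exp_neg_logRatio_le θ k q hq0 hq1 h)
      (mul_nonneg (measureReal_nonneg (μ := ν) (s := π.seedEvent h)) (Real.exp_pos (c * Y h)).le)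
    beta_reduce
    rw [Real.exp_add, neg_one_mul]
    linarith
  -- The chord bound `exp (c * Y) ≤ (1 - Y) + Y * exp c`. The constant 1 cancels the one from `1 + x
  -- ≤ exp x` in `h1`.
  have h3 : π.historyMean ν (Function.update θ k q) T (fun h => Real.exp (c * Y h)) ≤
      π.historyMean ν (Function.update θ k q) T (fun h => 1 + Real.exp c * Y h) := by
    refine π.historyMean_mono ν _ fun h hh => ?_
    obtain ⟨hy0, hy1⟩ := hY0 h hh
    have hconv := convexOn_exp.2 (Set.mem_univ 0) (Set.mem_univ c) (sub_nonneg.2 hy1) hy0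
      (sub_add_cancel 1 (Y h))
    simp only [smul_eq_mul, mul_zero, zero_add, Real.exp_zero, mul_one] at hconv
    rw [mul_comm c]
    linarith
  rw [Algorithm.historyMean_add, Algorithm.historyMean_add, Algorithm.historyMean_const_mul,
    Algorithm.historyMean_const_mul, Algorithm.historyMean_const,
    Algorithm.historyMean_logRatio, hmeanY] at h1
  rw [Algorithm.historyMean_add, Algorithm.historyMean_const_mul,
    Algorithm.historyMean_const, hmeanY] at h3
  linarith

end ChangeOfMeasure

end

end RateBandit

namespace RateBandit

noncomputable section

/-! ### Asymptotic lower bounds -/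

section Asymptotic

variable {K : ℕ} {S : Type*} [MeasurableSpace S]

lemma continuousAt_realKL {p q : ℝ} (hq0 : 0 < q) (hq1 : q < 1) (hp1 : p < 1) :
    ContinuousAt (realKL p) q := by
  have h1q : (1 - q) ≠ 0 := (sub_pos.2 hq1).ne'
  have hfst : ContinuousAt (fun x : ℝ => p * Real.log (p / x)) q := by
    rcases eq_or_ne p 0 with rfl | hp
    · simpa using continuousAt_const
    · exact continuousAt_const.mul
        ((continuousAt_const.div continuousAt_id hq0.ne').log (div_ne_zero hp hq0.ne'))
  exact hfst.add (continuousAt_const.mul ((continuousAt_const.div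
    (continuousAt_const.sub continuousAt_id) h1q).log
      (div_ne_zero (sub_pos.2 hp1).ne' h1q)))

lemma tendsto_log_natCast_atTop : Tendsto (fun T : ℕ => Real.log (T : ℝ)) atTop atTop :=
  Real.tendsto_log_atTop.comp tendsto_natCast_atTop_atTop

/-- If raising the mean of arm `k` to `q` makes it optimal, then a uniformly good algorithm uses
arm `k` at least `(β - o(1)) log T / I(θ_k, q)` times, for every `β < 1`. -/
lemma Algorithm.UniformlyGood.eventually_lt_realKL_mul {π : Algorithm K S} {ν : Measure S}
    [IsProbabilityMeasure ν] {r : Fin K → ℝ} (hπ : π.UniformlyGood ν r) {θ : Fin K → I}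
    {kstar : Fin K} (hkstar : IsOptimal r θ kstar) {k : Fin K} (hk : k ≠ kstar) {q : I}
    (hq0 : 0 < (q : ℝ)) (hq1 : (q : ℝ) < 1)
    (hq : IsOptimal r (Function.update θ k q) k) {β : ℝ} (hβ : β < 1) :
    ∀ᶠ T : ℕ in atTop,
      β < realKL (θ k) q * (π.expectedPulls ν θ k T / Real.log T) := by
  obtain ⟨γ, hβγ, hγ1⟩ := exists_between hβ
  have hu : Tendsto (fun T : ℕ => π.expectedPulls ν θ k T / T) atTop (𝓝 0) := by
    simpa using (hπ θ kstar hkstar 1 one_pos k hk).tendsto_div_nhds_zero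
  have hv : Tendsto (fun T : ℕ => (∑ l ∈ Finset.univ.erase k,
      π.expectedPulls ν (Function.update θ k q) l T) / (T : ℝ) ^ (1 - γ)) atTop (𝓝 0) := by
    have := IsLittleO.sum (s := Finset.univ.erase k) fun l hl => hπ _ k hq (1 - γ)
      (sub_pos.2 hγ1) l (Finset.ne_of_mem_erase hl)
    simpa using this.tendsto_div_nhds_zero
  have hlim : Tendsto (fun T : ℕ => γ * (1 - π.expectedPulls ν θ k T / T) -
      (∑ l ∈ Finset.univ.erase k, π.expectedPulls ν (Function.update θ k q) l T) /
        (T : ℝ) ^ (1 - γ) * (Real.log T)⁻¹) atTop (𝓝 γ) := by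
    have := ((tendsto_const_nhds (x := (1 : ℝ))).sub hu).const_mul γ |>.sub
      (hv.mul tendsto_log_natCast_atTop.inv_tendsto_atTop)
    simpa using this
  filter_upwards [hlim.eventually (lt_mem_nhds hβγ), eventually_gt_atTop 0,
    tendsto_log_natCast_atTop.eventually_gt_atTop 0] with T hT hT0 hlog
  refine hT.trans_le ?_
  have hTpos : (0 : ℝ) < T := Nat.cast_pos.2 hT0
  -- Here `exp c = T ^ γ`, while the changed mean of the test variable is `o(T ^ (-γ))`, so the
  -- error term tends to 0.
  have hmain := π.sub_le_realKL_mul_expectedPulls ν θ k q hq0 hq1 hT0 (γ * Real.log T)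
  have hrest : Real.exp (γ * Real.log T) *
      (1 - π.expectedPulls ν (Function.update θ k q) k T / T) =
      (∑ l ∈ Finset.univ.erase k, π.expectedPulls ν (Function.update θ k q) l T) /
        (T : ℝ) ^ (1 - γ) := by
    have hsum := π.sum_expectedPulls ν (Function.update θ k q) T
    rw [← Finset.add_sum_erase _ _ (Finset.mem_univ k)] at hsum
    rw [eq_sub_of_add_eq' hsum, Real.rpow_sub hTpos, Real.rpow_one, mul_comm γ,
      ← Real.rpow_def_of_pos hTpos]
    field_simp
  rw [hrest] at hmain
  rw [← mul_div_assoc, le_div_iff₀ hlog, sub_mul, inv_mul_cancel_right₀ hlog.ne']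
  linarith

/-- A uniformly good algorithm uses a suboptimal arm `k` that could be optimal at least
`(a - o(1)) log T` times, for every `a < 1 / I(θ_k, q)`, where `q` is the mean with which arm `k`
would be as good as the optimal one. -/
lemma Algorithm.UniformlyGood.eventually_lt_expectedPulls_div_log {π : Algorithm K S}
    {ν : Measure S} [IsProbabilityMeasure ν] {r : Fin K → ℝ} (hr : ∀ k, 0 < r k)
    (hπ : π.UniformlyGood ν r) {θ : Fin K → I} {kstar : Fin K} (hkstar : IsOptimal r θ kstar)
    {k : Fin K} (hk : k ≠ kstar) (hq1 : r kstar * θ kstar / r k < 1) {a : ℝ}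
    (ha : a * realKL (θ k) (r kstar * θ kstar / r k) < 1) :
    ∀ᶠ T : ℕ in atTop, a < π.expectedPulls ν θ k T / Real.log T := by
  have hpq : (θ k : ℝ) < r kstar * θ kstar / r k := by
    rw [lt_div_iff₀' (hr k)]
    exact hkstar k hk
  have hq0 : 0 < r kstar * θ kstar / r k := (θ k).2.1.trans_lt hpq
  have hcont : ∀ᶠ x in 𝓝[>] (r kstar * θ kstar / r k), a * realKL (θ k) x < 1 :=
    ((continuousAt_realKL hq0 hq1 (hpq.trans hq1)).const_mul a |>.eventually
      (gt_mem_nhds ha)).filter_mono nhdsWithin_le_nhds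
  -- Strictly above the threshold, so that `k` is the unique optimum; below 1, so that the
  -- divergence is finite.
  obtain ⟨x, hax, hqx, hx1⟩ := (hcont.and (Ioo_mem_nhdsGT hq1)).exists
  let q : I := ⟨x, (hq0.trans hqx).le, hx1.le⟩
  have hopt : IsOptimal r (Function.update θ k q) k := by
    intro l hl
    rw [Function.update_self, Function.update_of_ne hl]
    refine lt_of_le_of_lt ?_ ((div_lt_iff₀' (hr k)).1 hqx)
    rcases eq_or_ne l kstar with rfl | hls
    exacts [le_rfl, (hkstar l hls).le]
  -- The second use, with `β = 0`, yields positivity of the divergence.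
  filter_upwards [hπ.eventually_lt_realKL_mul hkstar hk (q := q) (hq0.trans hqx) hx1 hopt hax,
    hπ.eventually_lt_realKL_mul hkstar hk (q := q) (hq0.trans hqx) hx1 hopt zero_lt_one,
    tendsto_log_natCast_atTop.eventually_gt_atTop 0] with T h1 h2 hlog
  have hnonneg : 0 ≤ π.expectedPulls ν θ k T / Real.log T :=
    div_nonneg (π.expectedPulls_nonneg ν θ k T) hlog.le
  have hKL : 0 < realKL (θ k) q := pos_of_mul_pos_left h2 hnonneg
  rw [mul_comm (realKL (θ k) q)] at h1
  exact lt_of_mul_lt_mul_right h1 hKL.le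

lemma Algorithm.regret_eq_sum (π : Algorithm K S) (ν : Measure S) [IsProbabilityMeasure ν]
    (r : Fin K → ℝ) (θ : Fin K → I) (kstar : Fin K) (T : ℕ) :
    π.regret ν r θ kstar T =
      ∑ k, (r kstar * θ kstar - r k * θ k) * π.expectedPulls ν θ k T := by
  simp only [sub_mul, Finset.sum_sub_distrib, ← Finset.mul_sum]
  rw [π.sum_expectedPulls, Algorithm.regret, mul_comm (r kstar)]
  simp only [mul_comm (r _)]

lemma ereal_coe_sum {ι : Type*} (s : Finset ι) (f : ι → ℝ) :
    ((∑ i ∈ s, f i : ℝ) : EReal) = ∑ i ∈ s, (f i : EReal) :=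
  map_sum (⟨⟨Real.toEReal, EReal.coe_zero⟩, EReal.coe_add⟩ : ℝ →+ EReal) f s

open Classical in
/-- The contribution of arm `k` to the constant of the lower bound, as a real number. -/
def realTerm (r : Fin K → ℝ) (θ : Fin K → I) (kstar k : Fin K) : ℝ :=
  if r kstar * θ kstar / r k = 1 then 0
  else (r kstar * θ kstar - r k * θ k) / realKL (θ k) (r kstar * θ kstar / r k)

/-- The threshold exceeds `θ k ≥ 0`, so the divergence is infinite only when the threshold is 1,
where both sides are 0. -/
lemma coe_realTerm {r : Fin K → ℝ} (hr : ∀ k, 0 < r k) {θ : Fin K → I} {kstar : Fin K}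
    (hkstar : IsOptimal r θ kstar) {k : Fin K} (hk : k ≠ kstar)
    (hq1 : r kstar * θ kstar / r k ≤ 1) :
    ((r kstar * θ kstar - r k * θ k : ℝ) : EReal) /
      bernoulliKL (θ k) (r kstar * θ kstar / r k) = (realTerm r θ kstar k : EReal) := by
  have hpq : (θ k : ℝ) < r kstar * θ kstar / r k := by
    rw [lt_div_iff₀' (hr k)]
    exact hkstar k hk
  have hq0 : r kstar * θ kstar / r k ≠ 0 := ((θ k).2.1.trans_lt hpq).ne'
  have hp1 : (θ k : ℝ) ≠ 1 := (hpq.trans_le hq1).ne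
  unfold realTerm bernoulliKL
  by_cases hq : r kstar * θ kstar / r k = 1
  · rw [if_pos (Or.inr ⟨hq, hp1⟩), if_pos hq, EReal.div_top, EReal.coe_zero]
  · rw [if_neg (by simp [hq0, hq]), if_neg hq, EReal.coe_div]
    rfl

lemma Algorithm.UniformlyGood.eventually_le_mul_expectedPulls_div_log {π : Algorithm K S}
    {ν : Measure S} [IsProbabilityMeasure ν] {r : Fin K → ℝ} (hr : ∀ k, 0 < r k)
    (hπ : π.UniformlyGood ν r) {θ : Fin K → I} {kstar : Fin K} (hkstar : IsOptimal r θ kstar)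
    {k : Fin K} (hk : k ≠ kstar) (hq1 : r kstar * θ kstar / r k ≤ 1) {y : ℝ}
    (hy : y < realTerm r θ kstar k) :
    ∀ᶠ T : ℕ in atTop, y ≤
      (r kstar * θ kstar - r k * θ k) * (π.expectedPulls ν θ k T / Real.log T) := by
  have hgap : 0 < r kstar * θ kstar - r k * θ k := sub_pos.2 (hkstar k hk)
  rcases le_or_gt y 0 with hy0 | hy0
  · filter_upwards [tendsto_log_natCast_atTop.eventually_gt_atTop 0] with T hlog
    exact hy0.trans
      (mul_nonneg hgap.le (div_nonneg (π.expectedPulls_nonneg ν θ k T) hlog.le))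
  · rw [realTerm] at hy
    split_ifs at hy with hq
    · exact absurd hy hy0.not_gt
    · have hKL : 0 < realKL (θ k) (r kstar * θ kstar / r k) :=
        (div_pos_iff_of_pos_left hgap).1 (hy0.trans hy)
      have ha : y / (r kstar * θ kstar - r k * θ k) *
          realKL (θ k) (r kstar * θ kstar / r k) < 1 := by
        rw [div_mul_eq_mul_div, div_lt_one hgap]
        exact (lt_div_iff₀ hKL).1 hy
      filter_upwards [hπ.eventually_lt_expectedPulls_div_log hr hkstar hk
        (lt_of_le_of_ne hq1 hq) ha] with T hT
      exact ((div_lt_iff₀' hgap).1 hT).le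

end Asymptotic

end

end RateBandit

/-! ### Summation over the arms -/

theorem mainTheorem8 {K : ℕ} (r : Fin K → ℝ) (hr_pos : ∀ k, 0 < r k) (hr_mono : StrictMono r)
    {S : Type*} [MeasurableSpace S] (ν : Measure S) [IsProbabilityMeasure ν]
    (π : RateBandit.Algorithm K S) (hπ : π.UniformlyGood ν r)
    (θ : Fin K → unitInterval) (kstar : Fin K) (hkstar : RateBandit.IsOptimal r θ kstar)
    (k₀ : Fin K)
    (hk₀ : IsLeast {k : Fin K | k ≤ kstar ∧ r kstar * θ kstar / r k ≤ 1} k₀) :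
    RateBandit.lowerConstant r θ kstar k₀ ≤
      liminf (fun T : ℕ => ((π.regret ν r θ kstar T / Real.log T : ℝ) : EReal)) atTop := by
  set s := (Finset.Ici k₀).erase kstar with hs
  have hne : ∀ k ∈ s, k ≠ kstar := fun k hk => Finset.ne_of_mem_erase hk
  have hle : ∀ k ∈ s, r kstar * θ kstar / r k ≤ 1 := by
    intro k hk
    have hk' : k₀ ≤ k := Finset.mem_Ici.1 (Finset.mem_of_mem_erase hk)
    exact (div_le_div_of_nonneg_left (mul_nonneg (hr_pos kstar).le (θ kstar).2.1) (hr_pos k₀)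
      (hr_mono.monotone hk')).trans hk₀.1.2
  have hconst : RateBandit.lowerConstant r θ kstar k₀ =
      ((∑ k ∈ s, RateBandit.realTerm r θ kstar k : ℝ) : EReal) := by
    rw [RateBandit.ereal_coe_sum]
    exact Finset.sum_congr rfl fun k hk =>
      RateBandit.coe_realTerm hr_pos hkstar (hne k hk) (hle k hk)
  rw [hconst]
  refine le_of_forall_lt fun z hz => ?_
  obtain ⟨x, hzx, hx⟩ := EReal.lt_iff_exists_real_btwn.1 hz
  refine hzx.trans_le (le_liminf_of_le (by isBoundedDefault) ?_)
  have hx' : x < ∑ k ∈ s, RateBandit.realTerm r θ kstar k := EReal.coe_lt_coe_iff.1 hx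
  -- The slack is shared among the arms; the `+ 1` covers an empty `s`.
  set δ := (∑ k ∈ s, RateBandit.realTerm r θ kstar k - x) / (s.card + 1) with hδ
  have hδ0 : 0 < δ := div_pos (sub_pos.2 hx') (by positivity)
  have hδs : s.card * δ ≤ ∑ k ∈ s, RateBandit.realTerm r θ kstar k - x := by
    have : (s.card + 1) * δ = ∑ k ∈ s, RateBandit.realTerm r θ kstar k - x :=
      mul_div_cancel₀ _ (by positivity)
    linarith
  have hev := (Filter.eventually_all_finset s).2 fun k hk =>
    hπ.eventually_le_mul_expectedPulls_div_log hr_pos hkstar (hne k hk) (hle k hk)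
      (sub_lt_self (RateBandit.realTerm r θ kstar k) hδ0)
  filter_upwards [hev, RateBandit.tendsto_log_natCast_atTop.eventually_gt_atTop 0] with T hT hlog
  rw [EReal.coe_le_coe_iff, π.regret_eq_sum, Finset.sum_div]
  calc x ≤ ∑ k ∈ s, (RateBandit.realTerm r θ kstar k - δ) := by
        rw [Finset.sum_sub_distrib, Finset.sum_const, nsmul_eq_mul]
        linarith
    _ ≤ ∑ k ∈ s, (r kstar * θ kstar - r k * θ k) * π.expectedPulls ν θ k T / Real.log T :=
        Finset.sum_le_sum fun k hk => (hT k hk).trans_eq (mul_div_assoc _ _ _).symm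
    _ ≤ _ := by
        -- Arms outside `s` contribute nonnegatively, and `kstar` contributes 0.
        refine Finset.sum_le_univ_sum_of_nonneg fun k => ?_
        refine div_nonneg (mul_nonneg ?_ (π.expectedPulls_nonneg ν θ k T)) hlog.le
        rcases eq_or_ne k kstar with rfl | hk
        exacts [(sub_self _).ge, (sub_pos.2 (hkstar k hk)).le]
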